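/- \textbf{Definitions.} Let $G=(V,E)$ be a finite simple graph and let $E'\subseteq V\times V$ be obtained by choosing one orientation of each edge of $G$. The automaton $\mathcal A_G$ has alphabet $V$ and set of states $E'\cup\{id\}$. The state $id$ acts trivially on all words. A state $e=(x,y)\in E'$ acts on words over $V$ by fixing the empty word and by \[ e(xw)=y\,e(w),\qquad e(yw)=x\,w,\qquad e(zw)=z\,w\quad(z\neq x,y). \] For $n\ge 1$, the Schreier graph $\Gamma_n^G$ is the multigraph with vertex set $V^n$ that has, for every state $q$ and every word $u\in V^n$, one edge joining $u$ and $q(u)$ (so loops and parallel edges occur). The Szeged index of a finite multigraph $H$ is \[ \mathrm{Sz}(H)=\sum_{e\in E(H),\ e=\{u,v\}} n(u,v)\,n(v,u), \] where the sum runs over all edges, counted with multiplicity, and $n(u,v)$ denotes the number of vertices of $H$ that are closer to $u$ than to $v$ (so loops contribute $0$). \textbf{Theorem.} Let $G$ be a tree on $k\ge 2$ vertices and let $n\ge 1$. Then, for every choice of the orientation of the edges of $G$, \[ \begin{aligned} \mathrm{Sz}(\Gamma_n^G)={}&\frac{2(k-1)^2(2k^2-2k-1)}{k^3(2k-1)}\,2^n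 k^{2n}-\frac{4(k-1)^2}{k^2}\,n k^{2n}\\ &+\frac{4(k+1)(k-1)}{k^3}\,k^{2n}-\frac{4(k+1)(k-1)}{k(2k-1)}\,k^n\\ &+\left(\frac{4}{k^2}\,n k^{2n}-\frac{2(k^2+2)}{k^3(k-1)}\,k^{2n}+\frac{2(k+2)}{k^2(k-1)}\,k^n\right)\mathrm{Sz}(G). \end{aligned} \] -/

import Mathlib

/-- A transducer with set of states `Q` and alphabet `X`. -/
structure Transducer (Q X : Type*) where
  /-- The restriction map `λ`. -/
  restr : Q → X → Q
  /-- The output map `η`. -/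
  out : Q → X → X

namespace Transducer

variable {Q X : Type*}

/-- The action of a state on the words of length `n`:
`η(q, x w) = η(q, x) η(λ(q, x), w)` for a letter `x` and a word `w`. -/
def act (A : Transducer Q X) : (n : ℕ) → Q → (Fin n → X) → (Fin n → X)
  | 0, _, w => w
  | n + 1, q, w => Fin.cons (A.out q (w 0)) (act A n (A.restr q (w 0)) (Fin.tail w))

/-- The `n`-th Schreier graph, as a multigraph. Its vertices are the words of length `n`; for every
state `q` and every word `u` there is one edge, joining `u` with the image of `u` under `q`. -/
def schreierGraph (A : Transducer Q X) (n : ℕ) : Graph (Fin n → X) (Q × (Fin n → X)) where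
  vertexSet := Set.univ
  edgeSet := Set.univ
  IsLink a x y := s(a.2, A.act n a.1 a.2) = s(x, y)
  isLink_symm := fun _ _ => ⟨fun _ _ h => h.trans Sym2.eq_swap⟩
  eq_or_eq_of_isLink_of_isLink := by
    intro a x y v w h h'
    have := h.symm.trans h'
    rw [Sym2.eq_iff] at this
    tauto
  edge_mem_iff_exists_isLink := fun _ => ⟨fun _ => ⟨_, _, rfl⟩, fun _ => Set.mem_univ _⟩
  left_mem_of_isLink := fun _ _ _ _ => Set.mem_univ _

end Transducer

/-- `E'` is obtained from the edge set of `G` by choosing an orientation of each edge. -/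
def SimpleGraph.IsOrientation {V : Type*} (G : SimpleGraph V) (E' : Set (V × V)) : Prop :=
  (∀ x y, (x, y) ∈ E' → G.Adj x y) ∧
    ∀ x y, G.Adj x y → Xor ((x, y) ∈ E') ((y, x) ∈ E')

/-- The automaton of a graph whose set of oriented edges is `E'`. The states are the oriented edges
`some e` and the sink `none`, which is the state `id`. -/
def graphAutomaton {V : Type*} [DecidableEq V] (E' : Set (V × V)) :
    Transducer (Option E') V where
  restr
    | none, _ => none
    | some e, z => if z = e.1.1 then some e else none
  out
    | none, z => z
    | some e, z => if z = e.1.1 then e.1.2 else if z = e.1.2 then e.1.1 else z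

namespace Graph

variable {α β : Type*}

/-- `H.closer u v` is the number of vertices of `H` that are closer to `u` than to `v`. Parallel
edges and loops do not affect distances, so these are taken in the underlying simple graph. -/
noncomputable def closer (H : Graph α β) (u v : V(H)) : ℕ :=
  {w : V(H) | H.toSimpleGraph.edist w u < H.toSimpleGraph.edist w v}.ncard

/-- The product `n(u, v) * n(v, u)` for an edge `e` with ends `u` and `v`; it does not depend on
the order in which the ends are chosen, see `szegedTerm_eq`. -/
noncomputable def szegedTerm (H : Graph α β) (e : E(H)) : ℕ :=
  let h := (H.exists_isLink_of_mem_edgeSet e.2).choose_spec.choose_spec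
  H.closer ⟨_, h.left_mem⟩ ⟨_, h.right_mem⟩ * H.closer ⟨_, h.right_mem⟩ ⟨_, h.left_mem⟩

theorem szegedTerm_eq (H : Graph α β) (e : E(H)) {u v : α} (h : H.IsLink e.1 u v) :
    H.szegedTerm e = H.closer ⟨u, h.left_mem⟩ ⟨v, h.right_mem⟩ *
      H.closer ⟨v, h.right_mem⟩ ⟨u, h.left_mem⟩ := by
  have h' := (H.exists_isLink_of_mem_edgeSet e.2).choose_spec.choose_spec
  rcases h.eq_and_eq_or_eq_and_eq h' with ⟨hu, hv⟩ | ⟨hu, hv⟩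
  · simp only [szegedTerm, hu, hv]
  · simp only [szegedTerm, hu, hv]
    exact mul_comm _ _

/-- The Szeged index of a finite multigraph: the sum of `n(u, v) * n(v, u)` over its edges, where
each of several parallel edges counts. -/
noncomputable def szeged (H : Graph α β) : ℕ :=
  ∑ᶠ e : E(H), H.szegedTerm e

end Graph

/-! An oriented edge e = (x, y) acts on {x, y}^j as a binary odometer. Hence its orbits on V^n are
cycles of length 2^j: a prefix in {x, y}^j turns, while the rest of the word, empty or starting
outside {x, y}, stays fixed. As G is a tree, the cycles fit together like a cactus, and each is
gated: every word has a gate on the cycle, which only the edges of that cycle change (`IsGate`,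
`SimpleGraph.IsGatedCycle`). So an edge of a cycle of length 2m splits the words according to the
half-cycle containing their gate, and its Szeged term becomes a count of gates
(`IsGate.szegedTerm_eq`).

The count is recursive in the last letter: level n + 1 consists of k copies of level n, one per last
letter, and e changes the last letter only after the prefix x^n. Let p be the number of vertices on
the side of x in G - e. On the cycle through x^(n+1) and y^(n+1), two antipodal edges cut off p k^n
words and all others k^n words (`halfCard_bigGate`). Any other nontrivial cycle comes from such a
cycle of a lower level by appending letters. All constant words then lie on one side of each of its
edges; new copies are attached there, and the opposite part keeps its size
(`isSmallPart_smallPart`).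

Summed over the words, the contribution of e is affine in p(k - p) (`smallPartSum_succ`). Summing
over the k - 1 edges finishes the proof, since the p(k - p) add up to Sz(G). -/

/-! ### Distances on a cycle of even length. -/

namespace ZMod

theorem val_add_one_eq_ite {m : ℕ} (hm : 0 < m) (a : ZMod (2 * m)) :
    (a + 1).val = if a.val + 1 = 2 * m then 0 else a.val + 1 := by
  have : NeZero (2 * m) := ⟨by omega⟩
  have ha := a.val_lt
  have h1 : (1 : ZMod (2 * m)).val = 1 := by
    rw [ZMod.val_one_eq_one_mod, Nat.mod_eq_of_lt (by omega)]
  rw [ZMod.val_add, h1]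
  split_ifs with h
  · rw [h, Nat.mod_self]
  · exact Nat.mod_eq_of_lt (by omega)

/-- The distance from `0` to `a` along a cycle of length `N`. -/
def cycNorm {N : ℕ} (a : ZMod N) : ℕ := min a.val (N - a.val)

theorem cycNorm_zero (N : ℕ) : (0 : ZMod N).cycNorm = 0 := by
  simp [cycNorm]

theorem cycNorm_add_one_le {m : ℕ} (hm : 0 < m) (a : ZMod (2 * m)) :
    (a + 1).cycNorm ≤ a.cycNorm + 1 := by
  have : NeZero (2 * m) := ⟨by omega⟩
  have ha := a.val_lt
  simp only [cycNorm, val_add_one_eq_ite hm]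
  split_ifs <;> omega

theorem cycNorm_le_add_one {m : ℕ} (hm : 0 < m) (a : ZMod (2 * m)) :
    a.cycNorm ≤ (a + 1).cycNorm + 1 := by
  have : NeZero (2 * m) := ⟨by omega⟩
  have ha := a.val_lt
  simp only [cycNorm, val_add_one_eq_ite hm]
  split_ifs <;> omega

/-- Because the length is even, the distance from 0 rises for m steps, then falls for m steps, and
never stalls. -/
theorem cycNorm_lt_add_one_iff {m : ℕ} (hm : 0 < m) (a : ZMod (2 * m)) :
    a.cycNorm < (a + 1).cycNorm ↔ a.val < m := by
  have : NeZero (2 * m) := ⟨by omega⟩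
  have ha := a.val_lt
  simp only [cycNorm, val_add_one_eq_ite hm]
  split_ifs <;> omega

theorem cycNorm_add_one_lt_iff {m : ℕ} (hm : 0 < m) (a : ZMod (2 * m)) :
    (a + 1).cycNorm < a.cycNorm ↔ ¬ a.val < m := by
  have : NeZero (2 * m) := ⟨by omega⟩
  have ha := a.val_lt
  simp only [cycNorm, val_add_one_eq_ite hm]
  split_ifs <;> omega

end ZMod

/-! ### Gated cycles in a connected graph. -/

namespace SimpleGraph

variable {W : Type*} {H : SimpleGraph W} {m : ℕ} {t : W → ZMod (2 * m)} {c : ZMod (2 * m) → W}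

/-- The cycle `c` is gated in `H`: the map `t` sends each vertex to (the index of) its gate, and only
the edges of the cycle change the gate. -/
structure IsGatedCycle (H : SimpleGraph W) (t : W → ZMod (2 * m)) (c : ZMod (2 * m) → W) :
    Prop where
  pos : 0 < m
  gate : ∀ i, t (c i) = i
  adj : ∀ i, H.Adj (c i) (c (i + 1))
  eq_or : ∀ w w', H.Adj w w' → t w = t w' ∨
    ∃ i, (w = c i ∧ w' = c (i + 1)) ∨ (w' = c i ∧ w = c (i + 1))

/-- The left side drops by at most one along each edge: either the gate stays and the triangle
inequality applies, or the edge lies on the cycle and only the cyclic distance changes. -/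
theorem IsGatedCycle.le_length (h : IsGatedCycle H t c) (hH : H.Connected) (i : ZMod (2 * m))
    {w v : W} (p : H.Walk w v) (hv : v = c i) :
    H.dist w (c (t w)) + (i - t w).cycNorm ≤ p.length := by
  induction p with
  | nil => subst hv; simp [h.gate, ZMod.cycNorm_zero]
  | @cons w w' v hadj p ih =>
    have ih := ih hv
    rw [Walk.length_cons]
    rcases h.eq_or w w' hadj with h1 | ⟨j, ⟨rfl, rfl⟩ | ⟨rfl, rfl⟩⟩
    · rw [h1]
      have := hH.dist_triangle (u := w) (v := w') (w := c (t w'))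
      have h2 : H.dist w w' = 1 := dist_eq_one_iff_adj.2 hadj
      omega
    · simp only [h.gate, dist_self] at ih ⊢
      have := ZMod.cycNorm_add_one_le h.pos (i - (j + 1))
      rw [show i - (j + 1) + 1 = i - j by ring] at this
      omega
    · simp only [h.gate, dist_self] at ih ⊢
      have := ZMod.cycNorm_le_add_one h.pos (i - (j + 1))
      rw [show i - (j + 1) + 1 = i - j by ring] at this
      omega

theorem IsGatedCycle.dist_add_natCast_le (h : IsGatedCycle H t c) (hH : H.Connected)
    (a : ZMod (2 * m)) (r : ℕ) : H.dist (c a) (c (a + r)) ≤ r := by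
  induction r with
  | zero => simp
  | succ r ih =>
    have h1 := hH.dist_triangle (u := c a) (v := c (a + r)) (w := c (a + r + 1))
    have h2 : H.dist (c (a + r)) (c (a + r + 1)) = 1 := dist_eq_one_iff_adj.2 (h.adj _)
    rw [Nat.cast_succ, ← add_assoc]
    omega

theorem IsGatedCycle.dist_cycle_le (h : IsGatedCycle H t c) (hH : H.Connected)
    (a b : ZMod (2 * m)) : H.dist (c a) (c b) ≤ (b - a).cycNorm := by
  have : NeZero (2 * m) := ⟨by have := h.pos; omega⟩
  -- The two arcs: forwards from `a` to `b`, and forwards from `b` to `a`.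
  have h1 := h.dist_add_natCast_le hH a (b - a).val
  have h2 := h.dist_add_natCast_le hH b (-(b - a)).val
  rw [ZMod.natCast_zmod_val, dist_comm, show b + -(b - a) = a by ring] at h2
  rw [ZMod.natCast_zmod_val, show a + (b - a) = b by ring] at h1
  by_cases h0 : b - a = 0
  · rw [h0] at h1 ⊢
    simpa [ZMod.cycNorm_zero] using h1
  · rw [ZMod.neg_val, if_neg h0] at h2
    exact le_min h1 h2

theorem IsGatedCycle.edist_eq (h : IsGatedCycle H t c) (hH : H.Connected) (w : W)
    (i : ZMod (2 * m)) :
    H.edist w (c i) = ((H.dist w (c (t w)) + (i - t w).cycNorm : ℕ) : ℕ∞) := by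
  rw [← (hH w (c i)).coe_dist_eq_edist]
  congr 1
  apply le_antisymm
  · exact (hH.dist_triangle (v := c (t w))).trans (Nat.add_le_add_left (h.dist_cycle_le hH _ _) _)
  · obtain ⟨p, hp⟩ := hH.exists_walk_length_eq_dist w (c i)
    rw [← hp]
    exact h.le_length hH i p rfl

/-- The distance from `w` to its gate cancels, leaving a comparison of cyclic distances. -/
theorem IsGatedCycle.edist_lt_iff (h : IsGatedCycle H t c) (hH : H.Connected) (w : W)
    (i : ZMod (2 * m)) :
    H.edist w (c i) < H.edist w (c (i + 1)) ↔ (i - t w).val < m := by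
  rw [h.edist_eq hH, h.edist_eq hH, Nat.cast_lt, add_sub_right_comm,
    ← ZMod.cycNorm_lt_add_one_iff h.pos]
  omega

theorem IsGatedCycle.edist_lt_iff' (h : IsGatedCycle H t c) (hH : H.Connected) (w : W)
    (i : ZMod (2 * m)) :
    H.edist w (c (i + 1)) < H.edist w (c i) ↔ ¬ (i - t w).val < m := by
  rw [h.edist_eq hH, h.edist_eq hH, Nat.cast_lt, add_sub_right_comm,
    ← ZMod.cycNorm_add_one_lt_iff h.pos]
  omega

end SimpleGraph

/-! ### The action on words, and gates on the cycles of an oriented edge. -/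

theorem Fin.snoc_const {V : Type*} (n : ℕ) (a : V) :
    (Fin.snoc (fun _ : Fin n => a) a : Fin (n + 1) → V) = fun _ => a := by
  ext i
  refine Fin.lastCases ?_ (fun j => ?_) i <;> simp

theorem Fin.snoc_eq_const_iff {V : Type*} {n : ℕ} {w : Fin n → V} {z a : V} :
    (Fin.snoc w z : Fin (n + 1) → V) = (fun _ => a) ↔ w = (fun _ => a) ∧ z = a := by
  refine ⟨fun h => ?_, fun h => by rw [h.1, h.2, Fin.snoc_const]⟩
  rwa [← Fin.snoc_const n a, Fin.snoc_inj] at h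

theorem Fin.cons_eq_const_iff {V : Type*} {n : ℕ} {w : Fin n → V} {z a : V} :
    (Fin.cons z w : Fin (n + 1) → V) = (fun _ => a) ↔ z = a ∧ w = (fun _ => a) := by
  simp [funext_iff, Fin.forall_fin_succ]

section Words

variable {V : Type*} {E' : Set (V × V)}

/-- The words of length `n` all of whose letters are ends of `e`. -/
def bigOrbit (e : V × V) (n : ℕ) : Set (Fin n → V) :=
  {w | ∀ i, w i = e.1 ∨ w i = e.2}

theorem snoc_mem_bigOrbit {e : V × V} {n : ℕ} {w : Fin n → V} {z : V} :
    (Fin.snoc w z : Fin (n + 1) → V) ∈ bigOrbit e (n + 1) ↔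
      w ∈ bigOrbit e n ∧ (z = e.1 ∨ z = e.2) := by
  simp [bigOrbit, Fin.forall_fin_succ']

theorem const_mem_bigOrbit (e : V × V) (n : ℕ) : (fun _ => e.1) ∈ bigOrbit e n :=
  fun _ => Or.inl rfl

variable [DecidableEq V]

/-- The action of an oriented edge on words of length `n`. -/
abbrev edgeAct (e : E') {n : ℕ} (w : Fin n → V) : Fin n → V :=
  (graphAutomaton E').act n (some e) w

theorem act_none (n : ℕ) (w : Fin n → V) : (graphAutomaton E').act n none w = w := by
  induction n with
  | zero => rfl
  | succ n ih =>
    change Fin.cons (w 0) ((graphAutomaton E').act n none (Fin.tail w)) = w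
    rw [ih, Fin.cons_self_tail]

theorem edgeAct_cons (e : E') {n : ℕ} (z : V) (w : Fin n → V) :
    edgeAct e (Fin.cons z w : Fin (n + 1) → V) =
      Fin.cons ((graphAutomaton E').out (some e) z) (if z = e.1.1 then edgeAct e w else w) := by
  change (Fin.cons _ ((graphAutomaton E').act n
    (if z = e.1.1 then some e else none) w) : Fin (n + 1) → V) = _
  split_ifs
  · rfl
  · rw [act_none]; rfl

/-- The automaton is still in state `e` at the last letter only if every earlier letter was `e.1.1`.
-/
theorem edgeAct_snoc (e : E') {n : ℕ} (w : Fin n → V) (z : V) :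
    edgeAct e (Fin.snoc w z : Fin (n + 1) → V) = Fin.snoc (edgeAct e w)
      (if w = (fun _ => e.1.1) then (graphAutomaton E').out (some e) z else z) := by
  induction n with
  | zero =>
    rw [if_pos (Subsingleton.elim _ _)]
    ext i
    rw [Fin.fin_one_eq_zero i]
    rfl
  | succ n ih =>
    obtain ⟨a, w, rfl⟩ : ∃ a w', w = Fin.cons a w' := ⟨w 0, Fin.tail w, by simp⟩
    rw [← Fin.cons_snoc_eq_snoc_cons, edgeAct_cons, edgeAct_cons, ← Fin.cons_snoc_eq_snoc_cons]
    simp only [Fin.cons_eq_const_iff]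
    congr 1
    split_ifs with h1 h2 h2
    · rw [ih, if_pos h2.2]
    · rw [ih, if_neg (fun h => h2 ⟨h1, h⟩)]
    · exact absurd h2.1 h1
    · rfl

theorem out_some_left (e : E') : (graphAutomaton E').out (some e) e.1.1 = e.1.2 := by
  simp [graphAutomaton]

theorem out_some_right (e : E') : (graphAutomaton E').out (some e) e.1.2 = e.1.1 := by
  simp +contextual [graphAutomaton]

theorem out_some_of_ne (e : E') {z : V} (h1 : z ≠ e.1.1) (h2 : z ≠ e.1.2) :
    (graphAutomaton E').out (some e) z = z := by
  simp [graphAutomaton, h1, h2]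

theorem edgeAct_const_left (e : E') (n : ℕ) :
    edgeAct e (fun _ : Fin n => e.1.1) = fun _ => e.1.2 := by
  induction n with
  | zero => exact Subsingleton.elim _ _
  | succ n ih => rw [← Fin.snoc_const, edgeAct_snoc, ih, if_pos rfl, out_some_left, Fin.snoc_const]

/-- `S` is the side of the first end of `e` when `e` is removed. -/
structure IsSide (E' : Set (V × V)) (e : V × V) (S : Finset V) : Prop where
  left : e.1 ∈ S
  right : e.2 ∉ S
  other : ∀ f ∈ E', f ≠ e → (f.1 ∈ S ↔ f.2 ∈ S)

/-- The position on the cycle `bigOrbit e n` of the gate of a word. -/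
def bigGate (e : V × V) (S : Finset V) : (n : ℕ) → (Fin n → V) → ℕ
  | 0, _ => 0
  | n + 1, w =>
    if w (Fin.last n) = e.1 then bigGate e S n (Fin.init w) + 2 ^ n
    else if w (Fin.last n) = e.2 then bigGate e S n (Fin.init w)
    else if w (Fin.last n) ∈ S then 2 ^ (n + 1) - 1 else 0

variable {e : V × V} {S : Finset V}

theorem bigGate_snoc {n : ℕ} (w : Fin n → V) (z : V) :
    bigGate e S (n + 1) (Fin.snoc w z) = if z = e.1 then bigGate e S n w + 2 ^ n
      else if z = e.2 then bigGate e S n w else if z ∈ S then 2 ^ (n + 1) - 1 else 0 := by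
  simp [bigGate]

theorem bigGate_lt (n : ℕ) (w : Fin n → V) : bigGate e S n w < 2 ^ n := by
  induction n with
  | zero => simp [bigGate]
  | succ n ih =>
    have := ih (Fin.init w)
    rw [bigGate]
    have h2 := pow_succ 2 n
    split_ifs <;> omega

/-- The values are the positions of the constant words on `e.1` and `e.2`: a constant word is
separated from the cycle by the end of `e` on its own side. The same rule gives the default values
in `bigGate`. -/
theorem bigGate_const (hS : IsSide E' e S) (n : ℕ) (a : V) :
    bigGate e S n (fun _ => a) = if a ∈ S then 2 ^ n - 1 else 0 := by
  induction n with
  | zero => simp [bigGate]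
  | succ n ih =>
    rw [← Fin.snoc_const, bigGate_snoc, ih]
    have h2 := pow_succ 2 n
    have h3 : 0 < 2 ^ n := by positivity
    by_cases h : a = e.1
    · subst h
      simp only [hS.left, if_true]
      omega
    · by_cases h' : a = e.2
      · subst h'
        simp [hS.right, h]
      · simp [h, h']

/-- On `bigOrbit` the gate is a binary expansion, with `e.1` as digit 1, `e.2` as digit 0 and the
last letter most significant. -/
theorem bigGate_injOn (hne : e.1 ≠ e.2) (n : ℕ) : Set.InjOn (bigGate e S n) (bigOrbit e n) := by
  induction n with
  | zero => exact fun _ _ _ _ _ => Subsingleton.elim _ _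
  | succ n ih =>
    intro w hw w' hw' h
    obtain ⟨w, z, rfl⟩ : ∃ u z, w = Fin.snoc u z := ⟨Fin.init w, w (Fin.last n), by simp⟩
    obtain ⟨w', z', rfl⟩ : ∃ u z, w' = Fin.snoc u z := ⟨Fin.init w', w' (Fin.last n), by simp⟩
    rw [snoc_mem_bigOrbit] at hw hw'
    rw [bigGate_snoc, bigGate_snoc] at h
    have h1 := bigGate_lt (e := e) (S := S) n w
    have h2 := bigGate_lt (e := e) (S := S) n w'
    obtain ⟨hw, rfl | rfl⟩ := hw <;> obtain ⟨hw', rfl | rfl⟩ := hw' <;>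
      simp only [hne.symm, if_true, if_false] at h
    · rw [ih hw hw' (by omega)]
    · omega
    · omega
    · rw [ih hw hw' (by omega)]

/-- Only the prefix constantly `f.1.1` lets `f` change the last letter. There the gate survives
because both ends of `f` lie on the same side of `e`. -/
theorem bigGate_edgeAct_of_ne (hS : IsSide E' e S) (f : E') (hf : f.1 ≠ e) (n : ℕ)
    (w : Fin n → V) : bigGate e S n (edgeAct f w) = bigGate e S n w := by
  induction n with
  | zero => rfl
  | succ n ih =>
    obtain ⟨w, z, rfl⟩ : ∃ u z, w = Fin.snoc u z := ⟨Fin.init w, w (Fin.last n), by simp⟩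
    rw [edgeAct_snoc]
    split_ifs with h
    · subst h
      have hs := hS.other f f.2 hf
      by_cases h1 : z = f.1.1
      · subst h1
        rw [out_some_left, edgeAct_const_left, Fin.snoc_const, Fin.snoc_const, bigGate_const hS,
          bigGate_const hS]
        simp [hs]
      · by_cases h2 : z = f.1.2
        · subst h2
          rw [out_some_right, bigGate_snoc, bigGate_snoc, edgeAct_const_left]
          have h3 := bigGate_const hS n f.1.1
          have h4 := bigGate_const hS n f.1.2
          have h5 : f.1.1 ≠ f.1.2 := fun h => h1 h.symm
          have hl := hS.left
          have hr := hS.right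
          have e2 := pow_succ 2 n
          have e3 : 0 < 2 ^ n := by positivity
          split_ifs at * <;> first | omega | grind
        · rw [out_some_of_ne f h1 h2, bigGate_snoc, bigGate_snoc, ih]
    · rw [bigGate_snoc, bigGate_snoc, ih]

theorem bigGate_edgeAct_of_notMem (f : E') (n : ℕ) (w : Fin n → V) (hw : w ∉ bigOrbit f.1 n) :
    bigGate f.1 S n (edgeAct f w) = bigGate f.1 S n w := by
  induction n with
  | zero => rfl
  | succ n ih =>
    obtain ⟨w, z, rfl⟩ : ∃ u z, w = Fin.snoc u z := ⟨Fin.init w, w (Fin.last n), by simp⟩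
    rw [snoc_mem_bigOrbit] at hw
    rw [edgeAct_snoc]
    by_cases hz : z = f.1.1 ∨ z = f.1.2
    · have hw' : w ∉ bigOrbit f.1 n := fun h => hw ⟨h, hz⟩
      rw [if_neg, bigGate_snoc, bigGate_snoc, ih w hw']
      rintro rfl
      exact hw' (const_mem_bigOrbit _ _)
    · rw [not_or] at hz
      rw [out_some_of_ne f hz.1 hz.2, ite_self, bigGate_snoc, bigGate_snoc]
      simp [hz.1, hz.2]

/-- The odometer: the carry into the new top digit happens exactly when all earlier digits are 1. -/
theorem bigGate_edgeAct (f : E') (hf : f.1.1 ≠ f.1.2) (hS : IsSide E' f.1 S) (n : ℕ)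
    (w : Fin n → V) (hw : w ∈ bigOrbit f.1 n) :
    bigGate f.1 S n (edgeAct f w) =
      if w = (fun _ => f.1.1) then 0 else bigGate f.1 S n w + 1 := by
  induction n with
  | zero => rw [if_pos (Subsingleton.elim _ _)]; rfl
  | succ n ih =>
    obtain ⟨w, z, rfl⟩ : ∃ u z, w = Fin.snoc u z := ⟨Fin.init w, w (Fin.last n), by simp⟩
    rw [snoc_mem_bigOrbit] at hw
    have ih := ih w hw.1
    rw [edgeAct_snoc, bigGate_snoc, bigGate_snoc, ih]
    simp only [Fin.snoc_eq_const_iff]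
    have e3 : 0 < 2 ^ n := by positivity
    by_cases h : w = fun _ => f.1.1
    · have hb : bigGate f.1 S n w = 2 ^ n - 1 := by
        rw [h, bigGate_const hS, if_pos hS.left]
      rcases hw.2 with rfl | rfl
      · simp [h, out_some_left, hf.symm]
      · rw [hb]
        simp only [h, out_some_right, hf.symm, if_true, if_false, and_false]
        omega
    · rcases hw.2 with rfl | rfl
      · simp only [h, if_true, if_false, false_and]
        omega
      · simp only [h, hf.symm, if_true, if_false, false_and]

theorem edgeAct_mem_bigOrbit (f : E') (n : ℕ) (w : Fin n → V) (hw : w ∈ bigOrbit f.1 n) :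
    edgeAct f w ∈ bigOrbit f.1 n := by
  induction n with
  | zero => exact fun i => i.elim0
  | succ n ih =>
    obtain ⟨w, z, rfl⟩ : ∃ u z, w = Fin.snoc u z := ⟨Fin.init w, w (Fin.last n), by simp⟩
    rw [snoc_mem_bigOrbit] at hw
    rw [edgeAct_snoc, snoc_mem_bigOrbit]
    refine ⟨ih w hw.1, ?_⟩
    rcases hw.2 with rfl | rfl
    · rw [out_some_left]; split_ifs <;> simp
    · rw [out_some_right]; split_ifs <;> simp

/-- `T` sends each word to the position of its gate on a cycle `C` of length `2 * m`, along which
`e` acts as a rotation. -/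
structure IsGate (e : E') (m : ℕ) {n : ℕ} (C : Set (Fin n → V)) (T : (Fin n → V) → ZMod (2 * m)) :
    Prop where
  pos : 0 < m
  maps : ∀ w ∈ C, edgeAct e w ∈ C
  step : ∀ w ∈ C, T (edgeAct e w) = T w + 1
  inj : Set.InjOn T C
  other : ∀ (f : E') (w : Fin n → V), f ≠ e ∨ w ∉ C → T (edgeAct f w) = T w

theorem isGate_bigOrbit (f : E') (hf : f.1.1 ≠ f.1.2) (hS : IsSide E' f.1 S) (n : ℕ) :
    IsGate f (2 ^ n) (bigOrbit f.1 (n + 1)) (fun w => (bigGate f.1 S (n + 1) w : ZMod (2 * 2 ^ n)))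
    where
  pos := by positivity
  maps := edgeAct_mem_bigOrbit f _
  step w hw := by
    rw [bigGate_edgeAct f hf hS _ w hw]
    split_ifs with h
    · rw [h, bigGate_const hS, if_pos hS.left, ← Nat.cast_succ, Nat.succ_eq_add_one,
        Nat.sub_add_cancel Nat.one_le_two_pow, pow_succ', ZMod.natCast_self, Nat.cast_zero]
    · exact Nat.cast_succ _
  inj w hw w' hw' h := by
    refine bigGate_injOn (S := S) hf (n + 1) hw hw' ?_
    have h' := (ZMod.natCast_eq_natCast_iff' _ _ _).1 h
    rwa [Nat.mod_eq_of_lt, Nat.mod_eq_of_lt] at h' <;>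
      exact (bigGate_lt _ _).trans_eq (pow_succ' _ _)
  other g w h := by
    by_cases hg : g = f
    · subst hg
      rw [bigGate_edgeAct_of_notMem g _ w (h.resolve_left (fun h => h rfl))]
    · rw [bigGate_edgeAct_of_ne hS g (fun h => hg (Subtype.ext h))]

/-- The extension to words of length `n + 1` of a function on words of length `n` that is considered
on the words ending with `z`. -/
def snocExtend {α : Type*} {n : ℕ} (z : V) (T : (Fin n → V) → α) (w : Fin (n + 1) → V) : α :=
  if w (Fin.last n) = z then T (Fin.init w) else T (fun _ => z)

theorem snocExtend_snoc {α : Type*} {n : ℕ} (z : V) (T : (Fin n → V) → α) (w : Fin n → V) (z' : V) :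
    snocExtend z T (Fin.snoc w z') = if z' = z then T w else T (fun _ => z) := by
  simp [snocExtend]

/-- By `hz`, turning along `C` never alters the appended `z`. An edge `g` leaves the copy of `z`
only if `z` is an end of `g`, and then after a constant prefix on an end of `g`. Both such prefixes
have the gate of the constant word on `z`, so everything outside the copy can be given that gate. -/
theorem IsGate.isGate_snocExtend {f : E'} {m n : ℕ} {C : Set (Fin n → V)} {T : (Fin n → V) → ZMod (2 * m)}
    (h : IsGate f m C T) (z : V)
    (hz : (z ≠ f.1.1 ∧ z ≠ f.1.2) ∨ (fun _ => f.1.1) ∉ C) :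
    IsGate f m ((fun w => (Fin.snoc w z : Fin (n + 1) → V)) '' C) (snocExtend z T) := by
  have hact : ∀ w ∈ C, edgeAct f (Fin.snoc w z : Fin (n + 1) → V) = Fin.snoc (edgeAct f w) z := by
    intro w hw
    rw [edgeAct_snoc]
    rcases hz with hz | hz
    · rw [out_some_of_ne f hz.1 hz.2, ite_self]
    · rw [if_neg]
      rintro rfl
      exact hz hw
  refine ⟨h.pos, ?_, ?_, ?_, ?_⟩
  · rintro _ ⟨w, hw, rfl⟩
    exact ⟨_, h.maps w hw, (hact w hw).symm⟩
  · rintro _ ⟨w, hw, rfl⟩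
    rw [hact w hw, snocExtend_snoc, snocExtend_snoc, if_pos rfl, if_pos rfl, h.step w hw]
  · rintro _ ⟨w, hw, rfl⟩ _ ⟨w', hw', rfl⟩ heq
    simp only [snocExtend_snoc, if_true] at heq
    rw [h.inj hw hw' heq]
  · intro g w hg
    obtain ⟨w, z', rfl⟩ : ∃ u z, w = Fin.snoc u z := ⟨Fin.init w, w (Fin.last n), by simp⟩
    have hg' : z' = z → (g ≠ f ∨ w ∉ C) := by
      rintro rfl
      exact hg.imp_right fun h1 h2 => h1 ⟨w, h2, rfl⟩
    rw [edgeAct_snoc, snocExtend_snoc, snocExtend_snoc]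
    by_cases hw : w = fun _ => g.1.1
    · subst hw
      rw [if_pos rfl, edgeAct_const_left]
      have key : z = g.1.1 ∨ z = g.1.2 → T (fun _ => g.1.2) = T (fun _ => g.1.1) := by
        intro h1
        rw [← edgeAct_const_left]
        apply h.other
        by_cases h2 : g = f
        · subst h2
          rcases hz with hz | hz
          · tauto
          · exact Or.inr hz
        · exact Or.inl h2
      by_cases h1 : z' = g.1.1
      · subst h1
        rw [out_some_left]
        by_cases h3 : g.1.1 = z
        · rw [if_pos h3]; simp only [← h3]; split_ifs <;> simp [key, ← h3]
        · by_cases h4 : g.1.2 = z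
          · rw [if_pos h4, if_neg h3, h4]
          · rw [if_neg h3, if_neg h4]
      · by_cases h2 : z' = g.1.2
        · subst h2
          rw [out_some_right]
          by_cases h3 : g.1.2 = z
          · rw [if_pos h3]; simp only [← h3]; split_ifs <;> simp [key, ← h3]
          · by_cases h4 : g.1.1 = z
            · rw [if_pos h4, if_neg h3, key (Or.inl h4.symm), h4]
            · rw [if_neg h3, if_neg h4]
        · rw [out_some_of_ne g h1 h2]
          split_ifs with h3
          · rw [← edgeAct_const_left]; exact h.other _ _ (hg' h3)
          · rfl
    · rw [if_neg hw]
      split_ifs with h1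
      · exact h.other _ _ (hg' h1)
      · rfl

end Words

/-! ### Counting the words behind each half-cycle. -/

theorem Fin.sum_pi_snoc {V M : Type*} [Fintype V] [AddCommMonoid M] {n : ℕ}
    (F : (Fin (n + 1) → V) → M) :
    ∑ w, F w = ∑ w : Fin n → V, ∑ z, F (Fin.snoc w z) := by
  classical
  rw [← (Fin.snocEquiv fun _ => V).sum_comp, Fintype.sum_prod_type_right]
  rfl

theorem ZMod.val_natCast_sub_natCast_lt_iff {m a b : ℕ} (ha : a < 2 * m) (hb : b < 2 * m) :
    ((a : ZMod (2 * m)) - b).val < m ↔ (b ≤ a ∧ a < b + m) ∨ a + m < b := by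
  by_cases h : b ≤ a
  · rw [← Nat.cast_sub h, ZMod.val_natCast_of_lt (by omega)]
    omega
  · have h1 : ((a : ZMod (2 * m)) - b) = ((a + 2 * m - b : ℕ) : ZMod (2 * m)) := by
      rw [Nat.cast_sub (by omega), Nat.cast_add, ZMod.natCast_self, add_zero]
    rw [h1, ZMod.val_natCast_of_lt (by omega)]
    omega

section Counting

variable {V : Type*} [Fintype V] [DecidableEq V] {E' : Set (V × V)} {S : Finset V}

/-- The number of words whose gate lies on the half of the cycle behind `u`. -/
def halfCard {m n : ℕ} (T : (Fin n → V) → ZMod (2 * m)) (u : Fin n → V) : ℕ :=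
  (Finset.univ.filter fun w => (T u - T w).val < m).card

omit [DecidableEq V] in
theorem card_filter_not_half {m n : ℕ} (T : (Fin n → V) → ZMod (2 * m)) (u : Fin n → V) :
    (Finset.univ.filter fun w => ¬ (T u - T w).val < m).card =
      Fintype.card V ^ n - halfCard T u := by
  have h := Finset.card_filter_add_card_filter_not (s := (Finset.univ : Finset (Fin n → V)))
    (fun w => (T u - T w).val < m)
  rw [Finset.card_univ, Fintype.card_fun, Fintype.card_fin] at h
  unfold halfCard
  omega

omit [DecidableEq V] in
theorem halfCard_le {m n : ℕ} (T : (Fin n → V) → ZMod (2 * m)) (u : Fin n → V) :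
    halfCard T u ≤ Fintype.card V ^ n := by
  refine (Finset.card_le_univ _).trans_eq ?_
  rw [Fintype.card_fun, Fintype.card_fin]

theorem sum_ends {M : Type*} [AddCommMonoid M] {e : V × V} (he : e.1 ≠ e.2) (F : V → M) :
    ∑ z, F z = F e.1 + F e.2 + ∑ z with ¬ (z = e.1 ∨ z = e.2), F z := by
  rw [← Finset.sum_filter_add_sum_filter_not Finset.univ (fun z => z = e.1 ∨ z = e.2)]
  congr 1
  have : Finset.univ.filter (fun z => z = e.1 ∨ z = e.2) = {e.1, e.2} := by
    ext z; simp
  rw [this, Finset.sum_pair he]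

theorem sum_not_ends_ite {M : Type*} [AddCommMonoid M] {e : V × V} (hS : IsSide E' e S) (a b : M) :
    (∑ z with ¬ (z = e.1 ∨ z = e.2), if z ∈ S then a else b) =
      (S.card - 1) • a + (Fintype.card V - S.card - 1) • b := by
  rw [Finset.sum_ite, Finset.sum_const, Finset.sum_const, Finset.filter_filter,
    Finset.filter_filter]
  congr 2
  · rw [← Finset.card_erase_of_mem hS.left]
    congr 1
    ext z
    have := hS.right
    simp only [Finset.mem_filter, Finset.mem_univ, true_and, Finset.mem_erase]
    grind
  · rw [← Finset.card_compl, ← Finset.card_erase_of_mem (Finset.mem_compl.2 hS.right)]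
    congr 1
    ext z
    have := hS.left
    simp only [Finset.mem_filter, Finset.mem_univ, true_and, Finset.mem_erase, Finset.mem_compl]
    grind

omit [Fintype V] [DecidableEq V] in
theorem IsSide.card_pos {e : V × V} (hS : IsSide E' e S) : 0 < S.card :=
  Finset.card_pos.2 ⟨_, hS.left⟩

omit [DecidableEq V] in
theorem IsSide.card_lt {e : V × V} (hS : IsSide E' e S) : S.card < Fintype.card V :=
  Finset.card_lt_univ_of_notMem hS.right

/-- For a fixed prefix, the last letters `f.1.1` and `f.1.2` give antipodal gates, exactly one of
which counts: this is the summand 1. Each other copy has a single gate, the last position if its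
letter is in `S` and 0 otherwise. -/
theorem halfCard_bigGate_eq (f : E') (hf : f.1.1 ≠ f.1.2) (hS : IsSide E' f.1 S) (n : ℕ)
    (u : Fin (n + 1) → V) :
    halfCard (m := 2 ^ n) (fun w => (bigGate f.1 S (n + 1) w : ZMod (2 * 2 ^ n))) u =
      Fintype.card V ^ n * (1 +
        (S.card - 1) * (if bigGate f.1 S (n + 1) u = 2 * 2 ^ n - 1 ∨
          bigGate f.1 S (n + 1) u + 1 < 2 ^ n then 1 else 0) +
        (Fintype.card V - S.card - 1) * (if bigGate f.1 S (n + 1) u < 2 ^ n then 1 else 0)) := by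
  have hlt : ∀ w : Fin (n + 1) → V, bigGate f.1 S (n + 1) w < 2 * 2 ^ n := fun w =>
    (bigGate_lt _ _).trans_eq (pow_succ' _ _)
  have hu := hlt u
  set a := bigGate f.1 S (n + 1) u with ha
  have hpos : 0 < 2 ^ n := by positivity
  have key : ∀ w : Fin n → V, (∑ z, if ((a : ZMod (2 * 2 ^ n)) -
      (bigGate f.1 S (n + 1) (Fin.snoc w z) : ZMod (2 * 2 ^ n))).val < 2 ^ n then 1 else 0) =
      1 + (S.card - 1) * (if a = 2 * 2 ^ n - 1 ∨ a + 1 < 2 ^ n then 1 else 0) +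
        (Fintype.card V - S.card - 1) * (if a < 2 ^ n then 1 else 0) := by
    intro w
    have hw := bigGate_lt (e := f.1) (S := S) n w
    simp only [ZMod.val_natCast_sub_natCast_lt_iff hu (hlt _)]
    simp only [bigGate_snoc]
    rw [sum_ends hf]
    simp only [if_true, hf.symm, if_false, add_assoc]
    rw [← add_assoc]
    congr 1
    · split_ifs <;> omega
    · have h2 := sum_not_ends_ite hS (if a = 2 * 2 ^ n - 1 ∨ a + 1 < 2 ^ n then 1 else 0)
        (if a < 2 ^ n then 1 else 0)
      rw [smul_eq_mul, smul_eq_mul] at h2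
      rw [← h2]
      refine Finset.sum_congr rfl fun z hz => ?_
      simp only [Finset.mem_filter, Finset.mem_univ, true_and, not_or] at hz
      have hp2 := pow_succ' 2 n
      simp only [hz.1, hz.2, if_false]
      split_ifs <;> first | rfl | omega
  unfold halfCard
  rw [Finset.card_filter, Fin.sum_pi_snoc, Finset.sum_congr rfl fun w _ => key w, Finset.sum_const,
    Finset.card_univ, Fintype.card_fun, Fintype.card_fin, smul_eq_mul]

omit [Fintype V] in
theorem bigGate_eq_iff_const (f : E') (hf : f.1.1 ≠ f.1.2) (hS : IsSide E' f.1 S) (n : ℕ)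
    (u : Fin n → V) (hu : u ∈ bigOrbit f.1 n) :
    bigGate f.1 S n u + 1 = 2 ^ n ↔ u = fun _ => f.1.1 := by
  have h1 : bigGate f.1 S n (fun _ => f.1.1) + 1 = 2 ^ n := by
    rw [bigGate_const hS, if_pos hS.left, Nat.sub_add_cancel Nat.one_le_two_pow]
  constructor
  · intro h
    exact bigGate_injOn (S := S) hf n hu (const_mem_bigOrbit _ _) (by omega)
  · rintro rfl; exact h1

theorem halfCard_bigGate (f : E') (hf : f.1.1 ≠ f.1.2) (hS : IsSide E' f.1 S) (n : ℕ)
    (u : Fin n → V) (hu : u ∈ bigOrbit f.1 n) (z : V) (hz : z = f.1.1 ∨ z = f.1.2) :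
    halfCard (m := 2 ^ n) (fun w => (bigGate f.1 S (n + 1) w : ZMod (2 * 2 ^ n)))
      (Fin.snoc u z) = Fintype.card V ^ n *
        if u = (fun _ => f.1.1) then (if z = f.1.1 then S.card else Fintype.card V - S.card)
        else (if z = f.1.1 then 1 else Fintype.card V - 1) := by
  rw [halfCard_bigGate_eq f hf hS]
  have h1 := bigGate_eq_iff_const f hf hS n u hu
  have h2 := bigGate_lt (e := f.1) (S := S) n u
  have h3 := hS.card_pos
  have h4 := hS.card_lt
  congr 1
  rcases hz with rfl | rfl
  · rw [bigGate_snoc, if_pos rfl]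
    simp only [if_true, ← h1]
    split_ifs <;> omega
  · rw [bigGate_snoc, if_neg hf.symm, if_pos rfl]
    simp only [hf.symm, if_false, ← h1]
    split_ifs <;> omega

-- This decides on which side of an edge the copies added at the next level are attached.
omit [Fintype V] in
theorem half_bigGate_const_iff (f : E') (hf : f.1.1 ≠ f.1.2) (hS : IsSide E' f.1 S) (n : ℕ)
    (u : Fin n → V) (hu : u ∈ bigOrbit f.1 n) (z : V) (hz : z = f.1.1 ∨ z = f.1.2) (b : V) :
    ((bigGate f.1 S (n + 1) (Fin.snoc u z) : ZMod (2 * 2 ^ n)) -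
      (bigGate f.1 S (n + 1) (fun _ => b) : ZMod (2 * 2 ^ n))).val < 2 ^ n ↔
      if b ∈ S then (u = (fun _ => f.1.1) ↔ z = f.1.1) else z ≠ f.1.1 := by
  have hlt : ∀ w : Fin (n + 1) → V, bigGate f.1 S (n + 1) w < 2 * 2 ^ n := fun w =>
    (bigGate_lt _ _).trans_eq (pow_succ' _ _)
  rw [ZMod.val_natCast_sub_natCast_lt_iff (hlt _) (hlt _), bigGate_const hS]
  have h1 := bigGate_eq_iff_const f hf hS n u hu
  have h2 := bigGate_lt (e := f.1) (S := S) n u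
  have hp2 := pow_succ' 2 n
  rcases hz with rfl | rfl
  · rw [bigGate_snoc, if_pos rfl, ← h1]
    split_ifs <;> simp <;> omega
  · rw [bigGate_snoc, if_neg hf.symm, if_pos rfl, ← h1]
    split_ifs <;> simp [hf.symm] <;> omega

/-- The word `u` lies on a cycle of `e` that does not contain the constant words, and the edge that
joins `u` with its image under `e` separates `s` words from the constant words. -/
def IsSmallPart (e : E') {n : ℕ} (u : Fin n → V) (s : ℕ) : Prop :=
  ∃ (m : ℕ) (C : Set (Fin n → V)) (T : (Fin n → V) → ZMod (2 * m)) (b : Prop),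
    IsGate e m C T ∧ u ∈ C ∧ (fun _ => e.1.1) ∉ C ∧ (∀ a, (T u - T (fun _ => a)).val < m ↔ b) ∧
    (b → halfCard T u + s = Fintype.card V ^ n) ∧ (¬ b → halfCard T u = s)

theorem halfCard_snocExtend {m n : ℕ} (T : (Fin n → V) → ZMod (2 * m)) (u : Fin n → V) (z : V) :
    halfCard (snocExtend z T) (Fin.snoc u z) = halfCard T u +
      (Fintype.card V ^ (n + 1) - Fintype.card V ^ n) *
        if (T u - T (fun _ => z)).val < m then 1 else 0 := by
  unfold halfCard
  rw [Finset.card_filter, Finset.card_filter, Fin.sum_pi_snoc, Finset.sum_comm]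
  simp only [snocExtend_snoc, if_true]
  rw [← Finset.add_sum_erase _ _ (Finset.mem_univ z)]
  congr 1
  · simp
  · rw [Finset.sum_congr rfl (g := fun _ => Fintype.card V ^ n *
      if (T u - T (fun _ => z)).val < m then 1 else 0)]
    · rw [Finset.sum_const, smul_eq_mul, ← mul_assoc]
      congr 1
      rw [Finset.card_erase_of_mem (Finset.mem_univ z), Finset.card_univ,
        pow_succ', Nat.sub_mul, one_mul]
    · intro z' hz'
      have : z' ≠ z := by simpa using hz'
      simp only [this, if_false]
      rw [Finset.sum_const, Finset.card_univ, Fintype.card_fun, Fintype.card_fin, smul_eq_mul]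

/-- All words in the other copies, and all constant words, get the gate of the constant word on `z`.
So the part containing that gate absorbs every new word, and the other part keeps its size `s`. -/
theorem IsGate.isSmallPart_snoc {f : E'} {m n : ℕ} {C : Set (Fin n → V)}
    {T : (Fin n → V) → ZMod (2 * m)} (h : IsGate f m C T) {u : Fin n → V} (hu : u ∈ C) {z : V}
    (hz : (z ≠ f.1.1 ∧ z ≠ f.1.2) ∨ (fun _ => f.1.1) ∉ C) {s : ℕ}
    (hs : if (T u - T (fun _ => z)).val < m then halfCard T u + s = Fintype.card V ^ n
      else halfCard T u = s) :
    IsSmallPart f (Fin.snoc u z : Fin (n + 1) → V) s := by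
  refine ⟨m, _, _, (T u - T (fun _ => z)).val < m, h.isGate_snocExtend z hz, ⟨u, hu, rfl⟩, ?_, ?_, ?_, ?_⟩
  · rintro ⟨w, hw, hw'⟩
    rw [Fin.snoc_eq_const_iff] at hw'
    rcases hz with hz | hz
    · exact hz.1 hw'.2
    · exact hz (hw'.1 ▸ hw)
  · intro a
    have ha : snocExtend z T (fun _ => a) = T (fun _ => z) := by
      rw [← Fin.snoc_const, snocExtend_snoc]
      split_ifs with h
      · rw [h]
      · rfl
    rw [ha, snocExtend_snoc, if_pos rfl]
  · intro hb
    rw [if_pos hb] at hs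
    have := Nat.pow_le_pow_right (Fintype.card_pos_iff.2 ⟨z⟩) (Nat.le_succ n)
    rw [halfCard_snocExtend, if_pos hb]
    simp only [Nat.succ_eq_add_one] at this
    omega
  · intro hb
    rw [if_neg hb] at hs
    rw [halfCard_snocExtend, if_neg hb, hs, mul_zero, add_zero]

theorem IsSmallPart.snoc {f : E'} {n : ℕ} {u : Fin n → V} {s : ℕ} (h : IsSmallPart f u s) (z : V) :
    IsSmallPart f (Fin.snoc u z : Fin (n + 1) → V) s := by
  obtain ⟨m, C, T, b, hg, hu, hx, hb, h1, h2⟩ := h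
  refine hg.isSmallPart_snoc hu (Or.inr hx) ?_
  split_ifs with hh
  · exact h1 ((hb z).1 hh)
  · exact h2 fun hb' => hh ((hb z).2 hb')

open Classical in
/-- For a word outside `bigOrbit e n`, the size of the smaller of the two parts into which the edge
joining the word with its image under `e` cuts the words of length `n`. -/
noncomputable def smallPart (e : V × V) (S : Finset V) : (n : ℕ) → (Fin n → V) → ℕ
  | 0, _ => 0
  | n + 1, w =>
    if Fin.init w ∈ bigOrbit e n then
      if w (Fin.last n) = e.1 ∨ w (Fin.last n) = e.2 then 0
      else match n, Fin.init w with
        | 0, _ => 0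
        | l + 1, u => Fintype.card V ^ l * if Fin.init u = (fun _ => e.1) then
            (if w (Fin.last (l + 1)) ∈ S then Fintype.card V - S.card else S.card) else 1
    else smallPart e S n (Fin.init w)

variable {e : V × V}

theorem smallPart_of_mem {n : ℕ} {w : Fin n → V} (hw : w ∈ bigOrbit e n) :
    smallPart e S n w = 0 := by
  cases n with
  | zero => rfl
  | succ n =>
    obtain ⟨w, z, rfl⟩ : ∃ u z, w = Fin.snoc u z := ⟨Fin.init w, w (Fin.last n), by simp⟩
    rw [snoc_mem_bigOrbit] at hw
    simp [smallPart, hw.1, hw.2]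

theorem smallPart_snoc_of_notMem {n : ℕ} {w : Fin n → V} (hw : w ∉ bigOrbit e n) (z : V) :
    smallPart e S (n + 1) (Fin.snoc w z) = smallPart e S n w := by
  simp [smallPart, hw]

theorem smallPart_one (w : Fin 1 → V) : smallPart e S 1 w = 0 := by
  have : Fin.init w ∈ bigOrbit e 0 := fun i => i.elim0
  simp only [smallPart, this, ite_self]

theorem smallPart_snoc_snoc {n : ℕ} {w : Fin n → V} (hw : w ∈ bigOrbit e n) {z z' : V}
    (hz : z = e.1 ∨ z = e.2) (hz' : ¬ (z' = e.1 ∨ z' = e.2)) :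
    smallPart e S (n + 2) (Fin.snoc (Fin.snoc w z : Fin (n + 1) → V) z') =
      Fintype.card V ^ n * if w = (fun _ => e.1) then
        (if z' ∈ S then Fintype.card V - S.card else S.card) else 1 := by
  have : (Fin.snoc w z : Fin (n + 1) → V) ∈ bigOrbit e (n + 1) := snoc_mem_bigOrbit.2 ⟨hw, hz⟩
  simp only [smallPart, Fin.init_snoc, this, if_true, Fin.snoc_last, hz', if_false]

theorem isSmallPart_smallPart (f : E') (hf : f.1.1 ≠ f.1.2) (hS : IsSide E' f.1 S) (n : ℕ)
    (w : Fin n → V) (hw : w ∉ bigOrbit f.1 n) :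
    (smallPart f.1 S n w = 0 ∧ edgeAct f w = w) ∨ IsSmallPart f w (smallPart f.1 S n w) := by
  induction n with
  | zero => exact absurd (fun i => i.elim0) hw
  | succ n ih =>
    obtain ⟨w, z, rfl⟩ : ∃ u z, w = Fin.snoc u z := ⟨Fin.init w, w (Fin.last n), by simp⟩
    by_cases hw' : w ∈ bigOrbit f.1 n
    · have hz : ¬ (z = f.1.1 ∨ z = f.1.2) := fun hz => hw (snoc_mem_bigOrbit.2 ⟨hw', hz⟩)
      have hz2 := not_or.1 hz
      cases n with
      | zero =>
        -- The very first letter is off the edge, so the word is fixed and gives a loop.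
        refine Or.inl ⟨smallPart_one _, ?_⟩
        rw [edgeAct_snoc, out_some_of_ne f hz2.1 hz2.2, ite_self]
        rfl
      | succ n =>
        right
        obtain ⟨w, y, rfl⟩ : ∃ u z, w = Fin.snoc u z := ⟨Fin.init w, w (Fin.last n), by simp⟩
        have hw2 := snoc_mem_bigOrbit.1 hw'
        refine (isGate_bigOrbit f hf hS n).isSmallPart_snoc hw' (Or.inl hz2) ?_
        rw [smallPart_snoc_snoc hw2.1 hw2.2 hz, halfCard_bigGate f hf hS n w hw2.1 y hw2.2]
        simp only [half_bigGate_const_iff f hf hS n w hw2.1 y hw2.2]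
        have h3 := hS.card_pos
        have h4 := hS.card_lt
        have h5 : ∀ a b : ℕ, a + b = Fintype.card V → Fintype.card V ^ n * a +
            Fintype.card V ^ n * b = Fintype.card V ^ (n + 1) := by
          intro a b hab
          rw [← mul_add, hab, pow_succ]
        by_cases c1 : w = (fun _ => f.1.1) <;> by_cases c2 : y = f.1.1 <;> by_cases c3 : z ∈ S <;>
          simp only [c1, c2, c3, if_true, if_false, iff_true, iff_false, not_true, not_false_iff,
            ne_eq] <;>
          first | rfl | (apply h5; omega)
    · rw [smallPart_snoc_of_notMem hw']
      refine (ih w hw').imp (fun h => ⟨h.1, ?_⟩) (fun h => h.snoc z)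
      rw [edgeAct_snoc, h.2, if_neg]
      rintro rfl
      exact hw' (const_mem_bigOrbit _ _)

end Counting

/-! ### From gates to Szeged terms of the Schreier graph. -/

section Distances

open scoped Graph

variable {V : Type*} [Fintype V] [DecidableEq V] {E' : Set (V × V)}

-- Reading `f.2` stops the automaton, so the first letter can be moved along `f` with the tail
-- intact. Reading `f.1` passes the action of `f` on to the tail, which gives the induction.
omit [Fintype V] in
theorem setoid_rel_of_edgeAct (hconn : ∀ r : Setoid V, (∀ f ∈ E', r f.1 f.2) → ∀ x y, r x y) (n : ℕ)
    (r : Setoid (Fin n → V)) (hr : ∀ (f : E') w, r w (edgeAct f w)) (w w' : Fin n → V) :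
    r w w' := by
  induction n with
  | zero => rw [Subsingleton.elim w w']
  | succ n ih =>
    have h1 : ∀ (u : Fin n → V) (z z' : V), r (Fin.cons z u) (Fin.cons z' u) := by
      intro u
      refine hconn (r.comap fun z => (Fin.cons z u : Fin (n + 1) → V)) fun f hf => ?_
      change r (Fin.cons f.1 u) (Fin.cons f.2 u)
      by_cases hne : f.2 = f.1
      · rw [hne]
      · have := hr ⟨f, hf⟩ (Fin.cons f.2 u)
        rw [edgeAct_cons, out_some_right ⟨f, hf⟩, if_neg hne] at this
        exact r.symm this
    have h2 : ∀ (z : V) (u u' : Fin n → V), r (Fin.cons z u) (Fin.cons z u') := by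
      intro z
      refine ih (r.comap fun u => (Fin.cons z u : Fin (n + 1) → V)) fun f u => ?_
      change r (Fin.cons z u) (Fin.cons z (edgeAct f u))
      have := hr f (Fin.cons f.1.1 u)
      rw [edgeAct_cons, out_some_left, if_pos rfl] at this
      exact r.trans (h1 _ _ _) (r.trans this (h1 _ _ _))
    rw [← Fin.cons_self_tail w, ← Fin.cons_self_tail w']
    exact r.trans (h1 _ _ _) (h2 _ _ _)

/-- A word as a vertex of the Schreier graph. -/
def wordVertex (E' : Set (V × V)) {n : ℕ} (w : Fin n → V) :
    V((graphAutomaton E').schreierGraph n) := ⟨w, trivial⟩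

omit [Fintype V] in
theorem schreierGraph_toSimpleGraph_adj_edgeAct (f : E') {n : ℕ} {w : Fin n → V}
    (hw : w ≠ edgeAct f w) :
    ((graphAutomaton E').schreierGraph n).toSimpleGraph.Adj (wordVertex E' w)
      (wordVertex E' (edgeAct f w)) :=
  ⟨fun h => hw (congrArg Subtype.val h), (some f, w), rfl⟩

omit [Fintype V] in
theorem eq_edgeAct_of_schreierGraph_toSimpleGraph_adj {n : ℕ}
    {w w' : V((graphAutomaton E').schreierGraph n)}
    (h : ((graphAutomaton E').schreierGraph n).toSimpleGraph.Adj w w') :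
    ∃ f : E', w'.1 = edgeAct f w.1 ∨ w.1 = edgeAct f w'.1 := by
  obtain ⟨hne, ⟨q, v⟩, hq⟩ := h
  change s(v, (graphAutomaton E').act n q v) = s(w.1, w'.1) at hq
  cases q with
  | none =>
    rw [act_none, Sym2.eq_iff] at hq
    rcases hq with ⟨h1, h2⟩ | ⟨h1, h2⟩ <;> exact absurd (Subtype.ext (by rw [← h1, ← h2])) hne
  | some f =>
    rw [Sym2.eq_iff] at hq
    rcases hq with ⟨h1, h2⟩ | ⟨h1, h2⟩
    · exact ⟨f, Or.inl (by rw [← h1, ← h2])⟩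
    · exact ⟨f, Or.inr (by rw [← h1, ← h2])⟩

omit [Fintype V] in
theorem schreierGraph_toSimpleGraph_connected [Nonempty V]
    (hconn : ∀ r : Setoid V, (∀ f ∈ E', r f.1 f.2) → ∀ x y, r x y) (n : ℕ) :
    ((graphAutomaton E').schreierGraph n).toSimpleGraph.Connected := by
  have : Nonempty V((graphAutomaton E').schreierGraph n) :=
    ⟨wordVertex E' fun _ => Classical.arbitrary V⟩
  refine ⟨fun w w' => ?_⟩
  refine setoid_rel_of_edgeAct hconn n
    (((graphAutomaton E').schreierGraph n).toSimpleGraph.reachableSetoid.comap (wordVertex E'))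
    (fun f u => ?_) w.1 w'.1
  change SimpleGraph.Reachable _ (wordVertex E' u) (wordVertex E' (edgeAct f u))
  by_cases h : u = edgeAct f u
  · rw [← h]
  · exact (schreierGraph_toSimpleGraph_adj_edgeAct f h).reachable

omit [Fintype V] in
theorem IsGate.iterate {e : E'} {m n : ℕ} {C : Set (Fin n → V)} {T : (Fin n → V) → ZMod (2 * m)}
    (h : IsGate e m C T) {u : Fin n → V} (hu : u ∈ C) (r : ℕ) :
    (edgeAct e)^[r] u ∈ C ∧ T ((edgeAct e)^[r] u) = T u + r := by
  induction r with
  | zero => simp [hu]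
  | succ r ih =>
    rw [Function.iterate_succ_apply']
    refine ⟨h.maps _ ih.1, ?_⟩
    rw [h.step _ ih.1, ih.2, Nat.cast_succ, add_assoc]

omit [Fintype V] in
theorem IsGate.exists_isGatedCycle {e : E'} {m n : ℕ} {C : Set (Fin n → V)}
    {T : (Fin n → V) → ZMod (2 * m)} (h : IsGate e m C T) {u : Fin n → V} (hu : u ∈ C) :
    ∃ c : ZMod (2 * m) → V((graphAutomaton E').schreierGraph n),
      SimpleGraph.IsGatedCycle ((graphAutomaton E').schreierGraph n).toSimpleGraph
        (fun w => T w.1) c ∧ ∀ w ∈ C, c (T w) = wordVertex E' w := by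
  have hm := h.pos
  have : NeZero (2 * m) := ⟨by omega⟩
  -- This makes 1 ≠ 0 in `ZMod (2 * m)`, so consecutive points of the cycle differ.
  have : Fact (1 < 2 * m) := ⟨by omega⟩
  let c₀ : ZMod (2 * m) → (Fin n → V) := fun i => (edgeAct e)^[(i - T u).val] u
  have hC : ∀ i, c₀ i ∈ C := fun i => (h.iterate hu _).1
  have hT : ∀ i, T (c₀ i) = i := fun i => by
    rw [(h.iterate hu _).2, ZMod.natCast_zmod_val]; ring
  have hc : ∀ w ∈ C, c₀ (T w) = w := fun w hw => h.inj (hC _) hw (hT _)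
  have hstep : ∀ i, edgeAct e (c₀ i) = c₀ (i + 1) := fun i => by
    rw [← hc _ (h.maps _ (hC i)), h.step _ (hC i), hT]
  have hact : ∀ (f : E') (w : Fin n → V), T w = T (edgeAct f w) ∨
      ∃ i, w = c₀ i ∧ edgeAct f w = c₀ (i + 1) := by
    intro f w
    by_cases hf : f ≠ e ∨ w ∉ C
    · exact Or.inl (h.other f w hf).symm
    · simp only [not_or, not_not] at hf
      obtain ⟨rfl, hw⟩ := hf
      exact Or.inr ⟨T w, (hc w hw).symm, by rw [← hstep, hc w hw]⟩
  refine ⟨fun i => wordVertex E' (c₀ i), ⟨hm, hT, fun i => ?_, fun w w' hw => ?_⟩,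
    fun w hw => congrArg (wordVertex E') (hc w hw)⟩
  · have := schreierGraph_toSimpleGraph_adj_edgeAct e (w := c₀ i) (by
      rw [hstep]
      intro heq
      have h2 := congrArg T heq
      rw [hT, hT] at h2
      simp at h2)
    rwa [hstep] at this
  · obtain ⟨f, hf | hf⟩ := eq_edgeAct_of_schreierGraph_toSimpleGraph_adj hw
    · rw [hf]
      refine (hact f w.1).imp_right fun ⟨i, h1, h2⟩ => ⟨i, Or.inl ⟨Subtype.ext h1, Subtype.ext ?_⟩⟩
      exact hf.trans h2
    · rw [hf]
      refine (hact f w'.1).imp Eq.symm fun ⟨i, h1, h2⟩ =>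
        ⟨i, Or.inr ⟨Subtype.ext h1, Subtype.ext ?_⟩⟩
      exact hf.trans h2

theorem ncard_setOf_wordVertex {n : ℕ} (P : (Fin n → V) → Prop) [DecidablePred P] :
    {w : V((graphAutomaton E').schreierGraph n) | P w.1}.ncard =
      (Finset.univ.filter P).card := by
  rw [← Set.ncard_coe_finset, ← Set.ncard_image_of_injective _ Subtype.val_injective]
  congr 1
  ext w
  simp only [Set.mem_image, Set.mem_ofPred_eq, Finset.coe_filter, Finset.mem_univ, true_and]
  exact ⟨fun ⟨v, hv, h⟩ => h ▸ hv, fun h => ⟨⟨w, trivial⟩, h, rfl⟩⟩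

theorem IsGate.szegedTerm_eq [Nonempty V]
    (hconn : ∀ r : Setoid V, (∀ f ∈ E', r f.1 f.2) → ∀ x y, r x y)
    {e : E'} {m n : ℕ} {C : Set (Fin n → V)}
    {T : (Fin n → V) → ZMod (2 * m)} (h : IsGate e m C T) {u : Fin n → V} (hu : u ∈ C) :
    ((graphAutomaton E').schreierGraph n).szegedTerm ⟨(some e, u), trivial⟩ =
      halfCard T u * (Fintype.card V ^ n - halfCard T u) := by
  have hH := schreierGraph_toSimpleGraph_connected hconn n
  obtain ⟨c, hc, hcw⟩ := h.exists_isGatedCycle hu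
  have h1 := hcw u hu
  have h2 := hcw _ (h.maps u hu)
  rw [h.step u hu] at h2
  rw [Graph.szegedTerm_eq _ _ (u := u) (v := edgeAct e u) rfl]
  change Graph.closer _ (wordVertex E' u) (wordVertex E' (edgeAct e u)) *
    Graph.closer _ (wordVertex E' (edgeAct e u)) (wordVertex E' u) = _
  rw [← h1, ← h2]
  unfold Graph.closer
  simp only [hc.edist_lt_iff hH, hc.edist_lt_iff' hH]
  rw [ncard_setOf_wordVertex (fun w => (T u - T w).val < m),
    ncard_setOf_wordVertex (fun w => ¬ (T u - T w).val < m), card_filter_not_half]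
  rfl

omit [Fintype V] in
theorem szegedTerm_eq_zero {q : Option E'} {n : ℕ} {u : Fin n → V}
    (h : (graphAutomaton E').act n q u = u) :
    ((graphAutomaton E').schreierGraph n).szegedTerm ⟨(q, u), trivial⟩ = 0 := by
  rw [Graph.szegedTerm_eq _ _ (u := u) (v := u) (by
    change s(u, (graphAutomaton E').act n q u) = _; rw [h])]
  simp [Graph.closer]

theorem IsSmallPart.szegedTerm_eq [Nonempty V]
    (hconn : ∀ r : Setoid V, (∀ f ∈ E', r f.1 f.2) → ∀ x y, r x y)
    {e : E'} {n : ℕ} {u : Fin n → V} {s : ℕ} (h : IsSmallPart e u s) :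
    (((graphAutomaton E').schreierGraph n).szegedTerm ⟨(some e, u), trivial⟩ : ℚ) =
      s * ((Fintype.card V : ℚ) ^ n - s) := by
  obtain ⟨m, C, T, b, hg, hu, -, -, h1, h2⟩ := h
  rw [hg.szegedTerm_eq hconn hu, Nat.cast_mul, Nat.cast_sub (halfCard_le T u), Nat.cast_pow]
  by_cases hb : b
  · have := congrArg (Nat.cast : ℕ → ℚ) (h1 hb)
    push_cast at this
    rw [← this]; ring
  · rw [h2 hb]

variable {S : Finset V}

-- The summands have disjoint supports, as `smallPart` vanishes on `bigOrbit`; both can thus be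
-- summed separately over all words.
open Classical in
theorem szegedTerm_edge [Nonempty V]
    (hconn : ∀ r : Setoid V, (∀ f ∈ E', r f.1 f.2) → ∀ x y, r x y)
    (f : E') (hf : f.1.1 ≠ f.1.2) (hS : IsSide E' f.1 S) (n : ℕ) (w : Fin (n + 1) → V) :
    (((graphAutomaton E').schreierGraph (n + 1)).szegedTerm ⟨(some f, w), trivial⟩ : ℚ) =
      smallPart f.1 S (n + 1) w * ((Fintype.card V : ℚ) ^ (n + 1) - smallPart f.1 S (n + 1) w) +
      if w ∈ bigOrbit f.1 (n + 1) then (Fintype.card V : ℚ) ^ (2 * n) *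
        (if Fin.init w = (fun _ => f.1.1) then (S.card : ℚ) * (Fintype.card V - S.card)
          else (Fintype.card V : ℚ) - 1) else 0 := by
  by_cases hw : w ∈ bigOrbit f.1 (n + 1)
  · rw [smallPart_of_mem hw, if_pos hw, (isGate_bigOrbit f hf hS n).szegedTerm_eq hconn hw]
    rw [Nat.cast_mul, Nat.cast_sub (halfCard_le _ _), Nat.cast_pow]
    obtain ⟨w, z, rfl⟩ : ∃ u z, w = Fin.snoc u z := ⟨Fin.init w, w (Fin.last n), by simp⟩
    rw [snoc_mem_bigOrbit] at hw
    rw [halfCard_bigGate f hf hS n w hw.1 z hw.2, Fin.init_snoc]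
    have h4 := hS.card_lt
    split_ifs <;> push_cast [Nat.cast_sub h4.le, Nat.cast_sub (show 1 ≤ Fintype.card V by omega)] <;>
      ring
  · rw [if_neg hw, add_zero]
    rcases isSmallPart_smallPart f hf hS _ w hw with ⟨h1, h2⟩ | h
    · rw [h1, szegedTerm_eq_zero h2]; simp
    · exact h.szegedTerm_eq hconn

end Distances

/-! ### The Szeged index of the tree itself. -/

section Tree

open scoped Graph

variable {V : Type*} {G : SimpleGraph V} {E' : Set (V × V)}

theorem SimpleGraph.IsOrientation.fst_ne_snd (hE' : G.IsOrientation E') {f : V × V} (hf : f ∈ E') :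
    f.1 ≠ f.2 :=
  (hE'.1 _ _ hf).ne

theorem SimpleGraph.IsOrientation.setoid_rel (hE' : G.IsOrientation E') (hG : G.Connected)
    (r : Setoid V) (hr : ∀ f ∈ E', r f.1 f.2) (x y : V) : r x y := by
  obtain ⟨p⟩ := hG x y
  induction p with
  | nil => exact r.refl _
  | cons h p ih =>
    refine r.trans ?_ ih
    rcases hE'.2 _ _ h with h | h
    · exact hr _ h.1
    · exact r.symm (hr _ h.1)

theorem SimpleGraph.IsOrientation.bijective (hE' : G.IsOrientation E') :
    Function.Bijective
      (fun f : E' => (⟨s(f.1.1, f.1.2), hE'.1 _ _ f.2⟩ : E(Graph.ofSimpleGraph G))) := by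
  constructor
  · rintro ⟨⟨a, b⟩, hf⟩ ⟨⟨c, d⟩, hg⟩ h
    have h := congrArg Subtype.val h
    simp only [Sym2.eq_iff] at h
    rcases h with ⟨rfl, rfl⟩ | ⟨rfl, rfl⟩
    · rfl
    · rcases hE'.2 _ _ (hE'.1 _ _ hf) with h | h
      · exact absurd hg h.2
      · exact absurd hf h.2
  · rintro ⟨e, he⟩
    induction e with
    | h x y =>
      rcases hE'.2 x y he with h | h
      · exact ⟨⟨(x, y), h.1⟩, rfl⟩
      · exact ⟨⟨(y, x), h.1⟩, Subtype.ext Sym2.eq_swap⟩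

theorem Graph.toSimpleGraph_ofSimpleGraph_connected (hG : G.Connected) :
    (Graph.ofSimpleGraph G).toSimpleGraph.Connected :=
  (Graph.toSimpleGraphOfSimpleGraphIso G).connected_iff.2 hG

-- A tree edge is a bridge; the side is the component of its first end after deletion.
open Classical in
theorem SimpleGraph.IsOrientation.exists_isSide (hE' : G.IsOrientation E') [Fintype V]
    (hG : G.IsTree) (f : E') : ∃ S : Finset V, IsSide E' f.1 S := by
  refine ⟨Finset.univ.filter fun z => (G.deleteEdges {s(f.1.1, f.1.2)}).Reachable f.1.1 z,
    by simp, ?_, ?_⟩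
  · have h := SimpleGraph.isAcyclic_iff_forall_adj_isBridge.1 hG.isAcyclic (hE'.1 _ _ f.2)
    rw [SimpleGraph.isBridge_iff] at h
    simpa using h
  · intro g hg hgf
    have hadj : (G.deleteEdges {s(f.1.1, f.1.2)}).Adj g.1 g.2 := by
      rw [SimpleGraph.deleteEdges_adj]
      refine ⟨hE'.1 _ _ hg, fun h => hgf ?_⟩
      have := hE'.bijective.1 (a₁ := ⟨g, hg⟩) (a₂ := f) (Subtype.ext h)
      exact congrArg Subtype.val this
    simp only [Finset.mem_filter, Finset.mem_univ, true_and]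
    exact ⟨fun h => h.trans hadj.reachable, fun h => h.trans hadj.reachable.symm⟩

/-- A bridge is treated as a gated cycle of length 2 (m = 1) whose gate map has the two sides as
fibres, so the distance criterion for cycles applies again. -/
theorem IsSide.szegedTerm_eq [Fintype V] (hE' : G.IsOrientation E') (hG : G.Connected) (f : E')
    {S : Finset V} (hS : IsSide E' f.1 S) :
    (Graph.ofSimpleGraph G).szegedTerm ⟨s(f.1.1, f.1.2), hE'.1 _ _ f.2⟩ =
      S.card * (Fintype.card V - S.card) := by
  classical
  have hH := Graph.toSimpleGraph_ofSimpleGraph_connected hG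
  let ι : V → V(Graph.ofSimpleGraph G) := fun z => ⟨z, trivial⟩
  let t : V(Graph.ofSimpleGraph G) → ZMod (2 * 1) := fun z => if z.1 ∈ S then 0 else 1
  let c : ZMod (2 * 1) → V(Graph.ofSimpleGraph G) := fun i => if i = 0 then ι f.1.1 else ι f.1.2
  have h01 : (1 : ZMod (2 * 1)) ≠ 0 := by decide
  have h11 : (1 : ZMod (2 * 1)) + 1 = 0 := by decide
  have hi : ∀ i : ZMod (2 * 1), i = 0 ∨ i = 1 := by decide
  have hadj : (Graph.ofSimpleGraph G).toSimpleGraph.Adj (ι f.1.1) (ι f.1.2) :=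
    ⟨fun h => hE'.fst_ne_snd f.2 (congrArg Subtype.val h),
      (Graph.ofSimpleGraph_adj_iff _ _).2 (hE'.1 _ _ f.2)⟩
  have key : ∀ g ∈ E', t (ι g.1) = t (ι g.2) ∨ (ι g.1 = c 0 ∧ ι g.2 = c (0 + 1)) := by
    intro g hg
    by_cases h : g = f.1
    · right
      rw [h]
      simp [c, h01]
    · left
      simp only [t, ι, hS.other g hg h]
  have hc : SimpleGraph.IsGatedCycle (Graph.ofSimpleGraph G).toSimpleGraph t c := by
    refine ⟨Nat.one_pos, fun i => ?_, fun i => ?_, fun w w' h => ?_⟩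
    · rcases hi i with rfl | rfl
      · simp [c, t, ι, hS.left]
      · simp [c, t, ι, hS.right, h01]
    · rcases hi i with rfl | rfl
      · simpa [c, h01] using hadj
      · simpa [c, h01, h11] using hadj.symm
    · have h := (Graph.ofSimpleGraph_adj_iff _ _).1 h.2
      rcases hE'.2 _ _ h with h | h
      · exact (key _ h.1).imp_right fun h => ⟨0, Or.inl h⟩
      · exact (key _ h.1).imp Eq.symm fun h => ⟨0, Or.inr h⟩
  have hval : ∀ w, ((0 : ZMod (2 * 1)) - t w).val < 1 ↔ w.1 ∈ S := by
    intro w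
    simp only [t]
    split_ifs with h
    · simp [h]
    · simp only [h, iff_false]; decide
  rw [Graph.szegedTerm_eq _ _ (u := f.1.1) (v := f.1.2)
    (show (Graph.ofSimpleGraph G).IsLink s(f.1.1, f.1.2) f.1.1 f.1.2 from ⟨rfl, hE'.1 _ _ f.2⟩)]
  change Graph.closer _ (c 0) (c (0 + 1)) * Graph.closer _ (c (0 + 1)) (c 0) = _
  unfold Graph.closer
  simp only [hc.edist_lt_iff hH, hc.edist_lt_iff' hH, hval]
  have hcard : ∀ U : Finset V,
      {w : V(Graph.ofSimpleGraph G) | w.1 ∈ U}.ncard = U.card := by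
    intro U
    rw [← Set.ncard_coe_finset, ← Set.ncard_image_of_injective _ Subtype.val_injective]
    congr 1
    ext w
    exact ⟨fun ⟨v, hv, h⟩ => h ▸ hv, fun h => ⟨⟨w, trivial⟩, h, rfl⟩⟩
  have h2 := hcard Sᶜ
  simp only [Finset.mem_compl] at h2
  rw [hcard S, h2, Finset.card_compl]

theorem szeged_ofSimpleGraph_eq_sum [Fintype V] [Fintype E'] (hE' : G.IsOrientation E')
    (hG : G.Connected) (S : E' → Finset V) (hS : ∀ f, IsSide E' f.1 (S f)) :
    (Graph.ofSimpleGraph G).szeged = ∑ f : E', (S f).card * (Fintype.card V - (S f).card) := by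
  rw [Graph.szeged, ← finsum_eq_of_bijective _ hE'.bijective fun f =>
    ((hS f).szegedTerm_eq hE' hG f).symm, finsum_eq_sum_of_fintype]

theorem SimpleGraph.IsOrientation.card_add_one [Fintype V] [Fintype E'] (hE' : G.IsOrientation E')
    (hG : G.IsTree) : Fintype.card E' + 1 = Fintype.card V := by
  classical
  rw [← hG.card_edgeFinset, SimpleGraph.edgeFinset_card]
  congr 1
  exact Fintype.card_congr (Equiv.ofBijective _ hE'.bijective)

end Tree

/-! ### Summation over words and the closed form for one edge. -/

section Sums

variable {V : Type*} [Fintype V] {E' : Set (V × V)} {S : Finset V} {e : V × V}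

open Classical in
theorem sum_bigOrbit_init (he : e.1 ≠ e.2) (n : ℕ) (φ : (Fin n → V) → ℚ) :
    (∑ w, if w ∈ bigOrbit e (n + 1) then φ (Fin.init w) else 0) =
      2 * ∑ w, if w ∈ bigOrbit e n then φ w else 0 := by
  rw [Fin.sum_pi_snoc, Finset.mul_sum]
  refine Finset.sum_congr rfl fun w _ => ?_
  simp only [snoc_mem_bigOrbit, Fin.init_snoc]
  by_cases hw : w ∈ bigOrbit e n
  · rw [sum_ends he]
    simp only [hw, true_and, true_or, or_true, if_true]
    rw [Finset.sum_eq_zero fun z hz => if_neg (Finset.mem_filter.1 hz).2]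
    ring
  · simp [hw]

open Classical in
theorem sum_bigOrbit_one (he : e.1 ≠ e.2) (n : ℕ) :
    (∑ w, if w ∈ bigOrbit e n then (1 : ℚ) else 0) = 2 ^ n := by
  induction n with
  | zero =>
    have : ∀ w : Fin 0 → V, w ∈ bigOrbit e 0 := fun w i => i.elim0
    simp [this]
  | succ n ih => rw [sum_bigOrbit_init he n fun _ => 1, ih, pow_succ']

variable [DecidableEq V]

open Classical in
theorem sum_bigOrbit_ite (he : e.1 ≠ e.2) (n : ℕ) (a b : ℚ) :
    (∑ w, if w ∈ bigOrbit e n then (if w = (fun _ => e.1) then a else b) else 0) =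
      a + (2 ^ n - 1) * b := by
  have h : ∀ w : Fin n → V, (if w ∈ bigOrbit e n then (if w = (fun _ => e.1) then a else b) else 0)
      = b * (if w ∈ bigOrbit e n then 1 else 0) + if w = (fun _ => e.1) then a - b else 0 := by
    intro w
    by_cases hw : w = fun _ => e.1
    · simp [hw, const_mem_bigOrbit]
    · simp [hw]
  rw [Finset.sum_congr rfl fun w _ => h w, Finset.sum_add_distrib, ← Finset.mul_sum,
    sum_bigOrbit_one he, Finset.sum_ite_eq' Finset.univ, if_pos (Finset.mem_univ _)]
  ring

/-- The contribution to the Szeged index, in a graph with `K` vertices, of the cycles of `e` that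
miss the constant words. -/
noncomputable def smallPartSum (e : V × V) (S : Finset V) (n : ℕ) (K : ℚ) : ℚ :=
  ∑ w : Fin n → V, (smallPart e S n w : ℚ) * (K - smallPart e S n w)

theorem smallPartSum_one (K : ℚ) : smallPartSum e S 1 K = 0 := by
  simp [smallPartSum, smallPart_one]

/-- Existing small cycles are copied k times; new ones arise by appending a letter off `e` to a word
of `bigOrbit`. Keeping `K` independent of the level is what lets the recursion close. -/
theorem smallPartSum_add_two (he : e.1 ≠ e.2) (hS : IsSide E' e S) (n : ℕ) (K : ℚ) {k p x : ℚ}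
    (hk : (Fintype.card V : ℚ) = k) (hp : (S.card : ℚ) = p) (hx : k ^ n = x) :
    smallPartSum e S (n + 2) K = k * smallPartSum e S (n + 1) K +
      2 * ((p - 1) * (x * (k - p) * (K - x * (k - p))) + (k - p - 1) * (x * p * (K - x * p)) +
        (2 ^ n - 1) * ((k - 2) * (x * (K - x)))) := by
  classical
  have h3 := hS.card_pos
  have h4 := hS.card_lt
  have hc1 : ((S.card - 1 : ℕ) : ℚ) = p - 1 := by rw [Nat.cast_sub h3, hp, Nat.cast_one]
  have hc2 : ((Fintype.card V - S.card : ℕ) : ℚ) = k - p := by rw [Nat.cast_sub h4.le, hk, hp]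
  have hc3 : ((Fintype.card V - S.card - 1 : ℕ) : ℚ) = k - p - 1 := by
    rw [Nat.cast_sub (by omega), hc2, Nat.cast_one]
  let a := x * (k - p) * (K - x * (k - p))
  let b := x * p * (K - x * p)
  have key : ∀ w : Fin (n + 1) → V,
      (∑ z, (smallPart e S (n + 2) (Fin.snoc w z) : ℚ) *
        (K - smallPart e S (n + 2) (Fin.snoc w z))) =
      k * (smallPart e S (n + 1) w * (K - smallPart e S (n + 1) w)) +
      if w ∈ bigOrbit e (n + 1) then (if Fin.init w = (fun _ => e.1) then
        (p - 1) * a + (k - p - 1) * b else (k - 2) * (x * (K - x))) else 0 := by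
    intro w
    by_cases hw : w ∈ bigOrbit e (n + 1)
    · rw [if_pos hw, smallPart_of_mem hw, Nat.cast_zero, zero_mul, mul_zero, zero_add]
      rw [sum_ends he, smallPart_of_mem (snoc_mem_bigOrbit.2 ⟨hw, Or.inl rfl⟩),
        smallPart_of_mem (snoc_mem_bigOrbit.2 ⟨hw, Or.inr rfl⟩), Nat.cast_zero, zero_mul, zero_add,
        zero_add]
      obtain ⟨w, y, rfl⟩ : ∃ u z, w = Fin.snoc u z := ⟨Fin.init w, w (Fin.last n), by simp⟩
      have hw2 := snoc_mem_bigOrbit.1 hw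
      rw [Fin.init_snoc]
      by_cases hc : w = fun _ => e.1
      · rw [if_pos hc, ← hc1, ← hc3, ← nsmul_eq_mul, ← nsmul_eq_mul, ← sum_not_ends_ite hS]
        refine Finset.sum_congr rfl fun z hz => ?_
        rw [smallPart_snoc_snoc hw2.1 hw2.2 (Finset.mem_filter.1 hz).2, if_pos hc]
        split_ifs
        · rw [Nat.cast_mul, Nat.cast_pow, hc2, hk, hx]
        · rw [Nat.cast_mul, Nat.cast_pow, hp, hk, hx]
      · have h5 : (k - 2) * (x * (K - x)) = (p - 1) * (x * (K - x)) + (k - p - 1) * (x * (K - x)) := by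
          ring
        rw [if_neg hc, h5, ← hc1, ← hc3, ← nsmul_eq_mul, ← nsmul_eq_mul, ← sum_not_ends_ite hS]
        refine Finset.sum_congr rfl fun z hz => ?_
        rw [smallPart_snoc_snoc hw2.1 hw2.2 (Finset.mem_filter.1 hz).2, if_neg hc, ite_self,
          mul_one, Nat.cast_pow, hk, hx]
    · simp only [smallPart_snoc_of_notMem hw, if_neg hw, add_zero]
      rw [Finset.sum_const, Finset.card_univ, nsmul_eq_mul, hk]
  unfold smallPartSum
  rw [Fin.sum_pi_snoc, Finset.sum_congr rfl fun w _ => key w, Finset.sum_add_distrib,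
    ← Finset.mul_sum,
    sum_bigOrbit_init he n fun w => if w = (fun _ => e.1) then
        (p - 1) * a + (k - p - 1) * b else (k - 2) * (x * (K - x)),
    sum_bigOrbit_ite he]

/-- The side enters only through p(k - p), because (p - 1)(k - p) + (k - p - 1)p = 2p(k - p) - k and
(p - 1)(k - p)² + (k - p - 1)p² = (k + 2)p(k - p) - k². The denominators come from geometric series
with ratios k and 2k. -/
theorem smallPartSum_succ (he : e.1 ≠ e.2) (hS : IsSide E' e S) (n : ℕ) (K : ℚ) {k p : ℚ}
    (hk : (Fintype.card V : ℚ) = k) (hp : (S.card : ℚ) = p) (hk2 : 2 ≤ k) :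
    smallPartSum e S (n + 1) K =
      K * (k ^ n / k * ((k - 2) * (2 * 2 ^ n - 2 - 2 * n) + 2 * n * (2 * (p * (k - p)) - k))) -
      k ^ n / k * ((k - 2) * ((2 * 2 ^ n * k ^ n - 2) / (2 * k - 1) - 2 * (k ^ n - 1) / (k - 1)) +
        2 * (p * (k - p) * (k + 2) - k ^ 2) * (k ^ n - 1) / (k - 1)) := by
  have h0 : k ≠ 0 := by linarith
  have h1 : k - 1 ≠ 0 := by linarith
  have h2 : 2 * k - 1 ≠ 0 := by linarith
  induction n with
  | zero => simp [smallPartSum_one]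
  | succ n ih =>
    rw [smallPartSum_add_two he hS n K hk hp rfl, ih]
    push_cast
    rw [pow_succ k n, pow_succ (2 : ℚ) n]
    generalize k ^ n = x
    generalize (2 : ℚ) ^ n = t
    obtain ⟨d, hd⟩ : ∃ d, 2 * k - 1 = d := ⟨_, rfl⟩
    rw [hd] at h2 ⊢
    field_simp
    rw [← hd]
    ring

open Classical in
theorem sum_szegedTerm_edge [Nonempty V]
    (hconn : ∀ r : Setoid V, (∀ f ∈ E', r f.1 f.2) → ∀ x y, r x y)
    (f : E') (hf : f.1.1 ≠ f.1.2) (hS : IsSide E' f.1 S) (n : ℕ) {k p : ℚ}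
    (hk : (Fintype.card V : ℚ) = k) (hp : (S.card : ℚ) = p) :
    ∑ w, (((graphAutomaton E').schreierGraph (n + 1)).szegedTerm ⟨(some f, w), trivial⟩ : ℚ) =
      smallPartSum f.1 S (n + 1) (k ^ (n + 1)) +
        k ^ (2 * n) * (2 * (p * (k - p) + (2 ^ n - 1) * (k - 1))) := by
  rw [Finset.sum_congr rfl fun w _ => szegedTerm_edge hconn f hf hS n w, Finset.sum_add_distrib]
  congr 1
  · simp only [hk, smallPartSum]
  · rw [← sum_bigOrbit_ite hf, ← sum_bigOrbit_init hf, Finset.mul_sum]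
    refine Finset.sum_congr rfl fun w _ => ?_
    rw [hk, hp]
    split_ifs <;> ring

theorem szeged_schreierGraph_eq_sum [Fintype E'] (n : ℕ) :
    ((graphAutomaton E').schreierGraph n).szeged =
      ∑ f : E', ∑ w, ((graphAutomaton E').schreierGraph n).szegedTerm ⟨(some f, w), trivial⟩ := by
  have h := finsum_comp_equiv (Equiv.Set.univ (Option E' × (Fin n → V))).symm
    (f := ((graphAutomaton E').schreierGraph n).szegedTerm)
  rw [Graph.szeged]
  refine h.symm.trans ?_
  rw [finsum_eq_sum_of_fintype, Fintype.sum_prod_type, Fintype.sum_option]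
  refine (congrArg₂ _ (Finset.sum_eq_zero fun w _ => ?_) rfl).trans (zero_add _)
  exact szegedTerm_eq_zero (act_none n w)

end Sums

theorem mainTheorem2 {V : Type*} [Fintype V] [DecidableEq V] (G : SimpleGraph V) (hG : G.IsTree)
    (E' : Set (V × V)) (hE' : G.IsOrientation E')
    (k : ℕ) (hk : Fintype.card V = k) (hk2 : 2 ≤ k) (n : ℕ) (hn : 1 ≤ n) :
    ((((graphAutomaton E').schreierGraph n).szeged : ℕ) : ℚ) =
      2 * ((k : ℚ) - 1) ^ 2 * (2 * (k : ℚ) ^ 2 - 2 * k - 1) / ((k : ℚ) ^ 3 * (2 * k - 1))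
          * (2 ^ n * (k : ℚ) ^ (2 * n))
        - 4 * ((k : ℚ) - 1) ^ 2 / (k : ℚ) ^ 2 * (n * (k : ℚ) ^ (2 * n))
        + 4 * ((k : ℚ) + 1) * ((k : ℚ) - 1) / (k : ℚ) ^ 3 * (k : ℚ) ^ (2 * n)
        - 4 * ((k : ℚ) + 1) * ((k : ℚ) - 1) / ((k : ℚ) * (2 * k - 1)) * (k : ℚ) ^ n
        + (4 / (k : ℚ) ^ 2 * (n * (k : ℚ) ^ (2 * n))
            - 2 * ((k : ℚ) ^ 2 + 2) / ((k : ℚ) ^ 3 * ((k : ℚ) - 1)) * (k : ℚ) ^ (2 * n)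
            + 2 * ((k : ℚ) + 2) / ((k : ℚ) ^ 2 * ((k : ℚ) - 1)) * (k : ℚ) ^ n)
          * ((Graph.ofSimpleGraph G).szeged : ℚ) := by
  classical
  have : Fintype E' := Fintype.ofFinite _
  have : Nonempty V := Fintype.card_pos_iff.1 (by omega)
  obtain ⟨m, rfl⟩ : ∃ m, n = m + 1 := ⟨n - 1, by omega⟩
  choose S hS using fun f : E' => hE'.exists_isSide hG f
  have hconn := hE'.setoid_rel hG.connected
  have hkQ : (Fintype.card V : ℚ) = k := by rw [hk]
  have hk2' : (2 : ℚ) ≤ k := by exact_mod_cast hk2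
  have hE : (Fintype.card E' : ℚ) = k - 1 := by
    rw [← hkQ, ← hE'.card_add_one hG]; push_cast; ring
  have hG' : ((Graph.ofSimpleGraph G).szeged : ℚ) =
      ∑ f : E', ((S f).card : ℚ) * (k - (S f).card) := by
    rw [szeged_ofSimpleGraph_eq_sum hE' hG.connected S hS, Nat.cast_sum]
    refine Finset.sum_congr rfl fun f _ => ?_
    rw [Nat.cast_mul, Nat.cast_sub (hS f).card_lt.le, hkQ]
  have hlin : ∀ a b : ℚ, ∑ f : E', (a + b * (((S f).card : ℚ) * (k - (S f).card))) =
      (k - 1) * a + b * (Graph.ofSimpleGraph G).szeged := by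
    intro a b
    rw [Finset.sum_add_distrib, ← Finset.mul_sum, hG', Finset.sum_const, Finset.card_univ,
      nsmul_eq_mul, hE]
  have h0 : (k : ℚ) ≠ 0 := by linarith
  have h1 : (k : ℚ) - 1 ≠ 0 := by linarith
  have h2 : 2 * (k : ℚ) - 1 ≠ 0 := by linarith
  rw [szeged_schreierGraph_eq_sum, Nat.cast_sum]
  simp only [Nat.cast_sum]
  have hterm : ∀ f : E', _ := fun f => (sum_szegedTerm_edge hconn f (hE'.fst_ne_snd f.2) (hS f) m
    hkQ rfl).trans (congrArg (· + _) (smallPartSum_succ (hE'.fst_ne_snd f.2) (hS f) m _ hkQ rfl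
    hk2'))
  -- The contribution of `f` is sorted as a + b p(k - p) with a and b independent of `f`, the shape
  -- required by `hlin`.
  rw [Finset.sum_congr rfl fun f _ => (hterm f).trans (?_ : _ = (
    (k : ℚ) ^ (m + 1) * ((k : ℚ) ^ m / k * ((k - 2) * (2 * 2 ^ m - 2 - 2 * m) - 2 * m * k)) -
      (k : ℚ) ^ m / k * ((k - 2) * ((2 * 2 ^ m * (k : ℚ) ^ m - 2) / (2 * k - 1) -
        2 * ((k : ℚ) ^ m - 1) / (k - 1)) - 2 * (k : ℚ) ^ 2 * ((k : ℚ) ^ m - 1) / (k - 1)) +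
      (k : ℚ) ^ (2 * m) * (2 * ((2 ^ m - 1) * (k - 1)))) +
    ((k : ℚ) ^ (m + 1) * ((k : ℚ) ^ m / k * (4 * m)) -
      (k : ℚ) ^ m / k * (2 * (k + 2) * ((k : ℚ) ^ m - 1) / (k - 1)) + 2 * (k : ℚ) ^ (2 * m)) *
      (((S f).card : ℚ) * (k - (S f).card))), hlin]
  · rw [show 2 * (m + 1) = m + m + 1 + 1 by ring, two_mul m]
    push_cast
    simp only [pow_succ _ (m + m + 1), pow_succ _ (m + m), pow_succ _ m, pow_add _ m m]
    generalize (Graph.ofSimpleGraph G).szeged = g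
    generalize (k : ℚ) ^ m = x
    generalize (2 : ℚ) ^ m = t
    obtain ⟨d, hd⟩ : ∃ d, 2 * (k : ℚ) - 1 = d := ⟨_, rfl⟩
    rw [hd] at h2 ⊢
    field_simp
    rw [← hd]
    ring
  · ring
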